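/- Let $n\ge 3$ be odd, put $r=\lfloor n/2\rfloor$, and let $D=(d_{ij})$ be a real symmetric $n\times n$ matrix, where $d_{ij}$ is the cost of the edge $\{i,j\}$ of the complete graph $K_n$. The traveling salesman problem (TSP) asks for a Hamiltonian cycle of $K_n$ whose total edge cost is minimum. Consider the mixed-integer semidefinite program in the $n\times n$ real matrix variables $X_1,\dots,X_r$ $$ \begin{aligned} \min\quad & \tfrac12\langle D,X_1\rangle\\ \text{s.t.}\quad & I_n+\sum_{i=1}^r X_i=J_n,\qquad I_n+\sum_{i=1}^r\cos\Bigl(\frac{2ij\pi}{n}\Bigr)X_i\succeq 0\quad (j=1,\dots,r),\\ & X_1=X_1^{\top}\in\{0,1\}^{n\times n},\qquad X_i=X_i^{\top},\ X_i\ge 0\ \text{entrywise}\quad (i=2,\dots,r), \end{aligned} $$ where $I_n$ is the identity matrix, $J_n$ the all-ones matrix, $\langle A,B\rangle=\operatorname{tr}(A^{\top}B)$, and $\succeq 0$ means positive semidefinite. This program is an exact formulation of the TSP, that is: 1. A matrix $Y$ is the $X_1$-component of some feasible solution if and only if $Y$ is the adjacency matrix of a Hamiltonian cycle of $K_n$.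 2. If $(X_1,\dots,X_r)$ is feasible and $X_1$ is the adjacency matrix of the Hamiltonian cycle $T$, then $\frac12\langle D,X_1\rangle$ equals the cost of $T$. 3. Both minima are attained and they are equal. 4. If $(X_1,\dots,X_r)$ is feasible and $X_1$ is the adjacency matrix of the Hamiltonian cycle $T$, then $(X_1,\dots,X_r)$ is optimal for the program if and only if $T$ is a minimum-cost Hamiltonian cycle. -/

import Mathlib

namespace TSPAssoc

/-- The trace inner product `⟨A, B⟩ = tr(Aᵀ B)` of real square matrices. -/
def traceInner {n : ℕ} (A B : Matrix (Fin n) (Fin n) ℝ) : ℝ :=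
  (A.transpose * B).trace

/-- Feasibility for the mixed-integer semidefinite program of order `n`, with `r = ⌊n/2⌋`.
The variables are `X 1, …, X r`; the values of `X` at all other indices are irrelevant. -/
structure IsFeasible (n : ℕ) (X : ℕ → Matrix (Fin n) (Fin n) ℝ) : Prop where
  sum_eq : 1 + ∑ i ∈ Finset.Icc 1 (n / 2), X i = Matrix.of fun _ _ => (1 : ℝ)
  lmi : ∀ j ∈ Finset.Icc 1 (n / 2),
    (1 + ∑ i ∈ Finset.Icc 1 (n / 2),
      Real.cos (2 * (i : ℝ) * (j : ℝ) * Real.pi / (n : ℝ)) • X i).PosSemidef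
  symm_one : (X 1).IsSymm
  binary_one : ∀ a b, X 1 a b = 0 ∨ X 1 a b = 1
  nonneg : ∀ i ∈ Finset.Icc 2 (n / 2), ∀ a b, 0 ≤ X i a b
  symm : ∀ i ∈ Finset.Icc 2 (n / 2), (X i).IsSymm

/-- The objective `½ ⟨D, X₁⟩` of the mixed-integer semidefinite program. -/
noncomputable def objective {n : ℕ} (D : Matrix (Fin n) (Fin n) ℝ)
    (X : ℕ → Matrix (Fin n) (Fin n) ℝ) : ℝ :=
  (1 / 2 : ℝ) * traceInner D (X 1)

/-- A Hamiltonian cycle of the complete graph on `n` vertices, presented as a closed walk. -/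
structure Tour (n : ℕ) where
  base : Fin n
  walk : (⊤ : SimpleGraph (Fin n)).Walk base base
  isHamiltonianCycle : walk.IsHamiltonianCycle

/-- The adjacency matrix of the cycle. -/
def Tour.adjMatrix {n : ℕ} (T : Tour n) : Matrix (Fin n) (Fin n) ℝ :=
  Matrix.of fun a b => if s(a, b) ∈ T.walk.edges then 1 else 0

/-- The cost of a tour: the sum of `D a b` over its edges `{a, b}`, each traversed once.
For symmetric `D` the direction of traversal does not matter. -/
def Tour.cost {n : ℕ} (D : Matrix (Fin n) (Fin n) ℝ) (T : Tour n) : ℝ :=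
  (T.walk.darts.map fun d => D d.fst d.snd).sum

end TSPAssoc

namespace TSPAssoc

open Matrix

/-! Write `M j` for the `j`-th constrained matrix and `c j = cos (2πj/n)`. For odd `n` the cosines
are discretely orthogonal, so the inequalities combine to `∑ 2 M j = n I - J` and `∑ 2 c j M j =
(n/2) X 1 - J`. The first identity vanishes as a quadratic form at the all-ones vector, so every `M
j` kills that vector, and the second then gives `X 1` row sums 2. On vectors of sum zero, `c j ≤ c
1` and `M j ⪰ 0` bound the quadratic form of `X 1` by `2 c 1 < 2`. Hence 2 is a simple eigenvalue,
so the 2-regular graph of `X 1` is connected: a Hamiltonian cycle (`IsFeasible.exists_tour`).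
Conversely, the distance matrices of a tour are feasible: each `M j` becomes the Gram matrix of
points on the unit circle (`Tour.isFeasible_distMatrix`). -/

/-! ### Orthogonality of the cosine coefficients -/

lemma sin_half_mul_dirichlet (r : ℕ) (a : ℝ) :
    Real.sin (a / 2) * (1 + 2 * ∑ j ∈ Finset.Icc 1 r, Real.cos (a * j)) =
      Real.sin ((2 * r + 1) * (a / 2)) := by
  induction r with
  | zero => simp
  | succ r ih =>
    rw [Finset.sum_Icc_succ_top (by omega)]
    have h1 : ((2 * ((r + 1 : ℕ) : ℝ) + 1) * (a / 2)) = a * ((r + 1 : ℕ) : ℝ) + a / 2 := by ring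
    have h2 : ((2 * (r : ℝ) + 1) * (a / 2)) = a * ((r + 1 : ℕ) : ℝ) - a / 2 := by push_cast; ring
    rw [h1, Real.sin_add]
    rw [h2, Real.sin_sub] at ih
    linear_combination ih

/-- At `a = 2πk/n` the right side of the Dirichlet identity is `sin (kπ) = 0`, while the factor `sin
(kπ/n)` is nonzero because `n ∤ k`. -/
lemma two_mul_sum_cos {r : ℕ} (k : ℤ) (hk : ¬ ((2 * r + 1 : ℕ) : ℤ) ∣ k) :
    2 * ∑ j ∈ Finset.Icc 1 r, Real.cos (2 * k * j * Real.pi / (2 * r + 1 : ℕ)) = -1 := by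
  have hn : ((2 * r + 1 : ℕ) : ℝ) ≠ 0 := by positivity
  have h := sin_half_mul_dirichlet r (2 * k * Real.pi / (2 * r + 1 : ℕ))
  have e1 : (2 * (r : ℝ) + 1) * (2 * k * Real.pi / (2 * r + 1 : ℕ) / 2) = k * Real.pi := by
    push_cast at hn ⊢
    field_simp
  rw [e1, Real.sin_int_mul_pi] at h
  have hs : Real.sin (2 * k * Real.pi / (2 * r + 1 : ℕ) / 2) ≠ 0 := by
    rw [Ne, Real.sin_eq_zero_iff]
    rintro ⟨m, hm⟩
    apply hk
    refine ⟨m, ?_⟩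
    have hpi := Real.pi_ne_zero
    field_simp at hm
    have : ((m * (2 * r + 1 : ℕ) : ℤ) : ℝ) = (k : ℤ) := by
      push_cast at hm ⊢
      linarith
    have := Int.cast_injective this
    rw [← this]; ring
  have h2 := (mul_eq_zero.mp h).resolve_left hs
  have e2 : ∀ j : ℕ, Real.cos (2 * k * Real.pi / (2 * r + 1 : ℕ) * j) =
      Real.cos (2 * k * j * Real.pi / (2 * r + 1 : ℕ)) := by
    intro j; congr 1; ring
  simp only [e2] at h2
  linarith

/-- The coefficient of `X i` in the `j`-th linear matrix inequality. -/
noncomputable def coeff (n i j : ℕ) : ℝ := Real.cos (2 * (i : ℝ) * (j : ℝ) * Real.pi / (n : ℝ))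

/-- The matrix constrained to be positive semidefinite in the `j`-th inequality. -/
noncomputable def lmiMatrix {n : ℕ} (X : ℕ → Matrix (Fin n) (Fin n) ℝ) (j : ℕ) :
    Matrix (Fin n) (Fin n) ℝ :=
  1 + ∑ i ∈ Finset.Icc 1 (n / 2), coeff n i j • X i

lemma two_mul_sum_coeff {n i : ℕ} (hodd : Odd n) (hi : i ∈ Finset.Icc 1 (n / 2)) :
    2 * ∑ j ∈ Finset.Icc 1 (n / 2), coeff n i j = -1 := by
  obtain ⟨r, rfl⟩ := hodd
  have hr : (2 * r + 1) / 2 = r := by omega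
  rw [Finset.mem_Icc] at hi
  rw [hr]
  have h := two_mul_sum_cos (r := r) i (by
    intro h
    have := Nat.le_of_dvd (by omega) (Int.natCast_dvd_natCast.mp h)
    omega)
  simpa [coeff] using h

/-- Product-to-sum leaves the frequencies `k - i` and `k + i`. Since `0 < k + i < n`, only `k - i`
can be divisible by `n`, and only when `i = k`. -/
lemma two_mul_sum_coeff_mul {n i k : ℕ} (hodd : Odd n) (hi : i ∈ Finset.Icc 1 (n / 2))
    (hk : k ∈ Finset.Icc 1 (n / 2)) :
    2 * ∑ j ∈ Finset.Icc 1 (n / 2), coeff n k j * coeff n i j =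
      (if i = k then (n : ℝ) / 2 else 0) - 1 := by
  obtain ⟨r, rfl⟩ := hodd
  have hr : (2 * r + 1) / 2 = r := by omega
  rw [Finset.mem_Icc] at hi hk
  rw [hr]
  have hplus := two_mul_sum_cos (r := r) ((k : ℤ) + i) (by
    intro h
    have h' : 2 * r + 1 ∣ k + i := by exact_mod_cast h
    have := Nat.le_of_dvd (by omega) h'
    omega)
  have hterm : ∀ j : ℕ, 2 * (coeff (2 * r + 1) k j * coeff (2 * r + 1) i j) =
      Real.cos (2 * (((k : ℤ) - i : ℤ) : ℝ) * j * Real.pi / (2 * r + 1 : ℕ)) +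
        Real.cos (2 * (((k : ℤ) + i : ℤ) : ℝ) * j * Real.pi / (2 * r + 1 : ℕ)) := by
    intro j
    rw [coeff, coeff, ← mul_assoc, Real.two_mul_cos_mul_cos]
    congr 2 <;> push_cast <;> ring
  rw [Finset.mul_sum]
  simp only [hterm]
  rw [Finset.sum_add_distrib]
  split_ifs with h
  · subst h
    simp only [sub_self, Int.cast_zero, mul_zero, zero_mul, zero_div, Real.cos_zero,
      Finset.sum_const, Nat.card_Icc, nsmul_eq_mul, mul_one]
    push_cast at hplus ⊢
    linarith
  · have hminus := two_mul_sum_cos (r := r) ((k : ℤ) - i) (by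
      intro h
      have h2 := Int.eq_zero_of_abs_lt_dvd h (by rw [abs_lt]; constructor <;> push_cast <;> omega)
      omega)
    linarith

lemma two_smul_sum_smul_lmiMatrix {n : ℕ} (X : ℕ → Matrix (Fin n) (Fin n) ℝ) (w : ℕ → ℝ) :
    ∑ j ∈ Finset.Icc 1 (n / 2), (2 * w j) • lmiMatrix X j =
      (2 * ∑ j ∈ Finset.Icc 1 (n / 2), w j) • (1 : Matrix (Fin n) (Fin n) ℝ) +
      ∑ i ∈ Finset.Icc 1 (n / 2),
        (2 * ∑ j ∈ Finset.Icc 1 (n / 2), w j * coeff n i j) • X i := by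
  simp only [lmiMatrix, smul_add, Finset.sum_add_distrib, Finset.smul_sum, smul_smul,
    Finset.mul_sum, Finset.sum_smul]
  congr 1
  rw [Finset.sum_comm]
  refine Finset.sum_congr rfl fun i _ => Finset.sum_congr rfl fun j _ => ?_
  rw [mul_assoc]

/-! ### Spectrum of `X 1` for a feasible solution -/

variable {n : ℕ} {X : ℕ → Matrix (Fin n) (Fin n) ℝ}

lemma IsFeasible.posSemidef (h : IsFeasible n X) {j : ℕ} (hj : j ∈ Finset.Icc 1 (n / 2)) :
    (lmiMatrix X j).PosSemidef := h.lmi j hj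

lemma IsFeasible.sum_lmiMatrix (h : IsFeasible n X) (hodd : Odd n) :
    ∑ j ∈ Finset.Icc 1 (n / 2), (2 : ℝ) • lmiMatrix X j =
      (n : ℝ) • (1 : Matrix (Fin n) (Fin n) ℝ) - Matrix.of fun _ _ => (1 : ℝ) := by
  have h1 := two_smul_sum_smul_lmiMatrix X (fun _ => 1)
  simp only [mul_one, one_mul] at h1
  have h2 : ∀ i ∈ Finset.Icc 1 (n / 2),
      (2 * ∑ j ∈ Finset.Icc 1 (n / 2), coeff n i j) • X i = (-1 : ℝ) • X i :=
    fun i hi => by rw [two_mul_sum_coeff hodd hi]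
  rw [h1, ← h.sum_eq, Finset.sum_congr rfl h2]
  have h3 : (n : ℝ) = 2 * (n / 2 : ℕ) + 1 := by
    have : n = 2 * (n / 2) + 1 := by obtain ⟨r, rfl⟩ := hodd; omega
    exact_mod_cast this
  simp only [h3, Finset.sum_const, Nat.card_Icc, ← Finset.smul_sum, nsmul_eq_mul,
    Nat.add_sub_cancel, mul_one]
  module

lemma IsFeasible.sum_coeff_smul_lmiMatrix (h : IsFeasible n X) (hodd : Odd n) (hn : 3 ≤ n) :
    ∑ j ∈ Finset.Icc 1 (n / 2), (2 * coeff n 1 j) • lmiMatrix X j =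
      ((n : ℝ) / 2) • X 1 - Matrix.of fun _ _ => (1 : ℝ) := by
  have h1mem : 1 ∈ Finset.Icc 1 (n / 2) := by rw [Finset.mem_Icc]; omega
  rw [two_smul_sum_smul_lmiMatrix, ← h.sum_eq, two_mul_sum_coeff hodd h1mem,
    Finset.sum_congr rfl fun i hi => by rw [two_mul_sum_coeff_mul hodd hi h1mem]]
  simp only [sub_smul, ite_smul, zero_smul, one_smul, Finset.sum_sub_distrib,
    Finset.sum_ite_eq', h1mem, if_true]
  module

lemma ones_mulVec (f : Fin n → ℝ) :
    (Matrix.of fun _ _ => (1 : ℝ) : Matrix (Fin n) (Fin n) ℝ) *ᵥ f = fun _ => ∑ a, f a := by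
  ext; simp [mulVec, dotProduct]

lemma IsFeasible.sum_dotProduct (h : IsFeasible n X) (hodd : Odd n) (f : Fin n → ℝ) :
    ∑ j ∈ Finset.Icc 1 (n / 2), 2 * (f ⬝ᵥ lmiMatrix X j *ᵥ f) =
      n * (f ⬝ᵥ f) - (∑ a, f a) ^ 2 := by
  have := congrArg (fun A => f ⬝ᵥ A *ᵥ f) (h.sum_lmiMatrix hodd)
  simp only [sum_mulVec, sub_mulVec, smul_mulVec, dotProduct_sum, dotProduct_sub,
    dotProduct_smul, one_mulVec, ones_mulVec, smul_eq_mul] at this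
  rw [this]
  simp [dotProduct, ← Finset.sum_mul, sq]

/-- Nonnegative quadratic forms with sum zero all vanish, and a positive semidefinite matrix kills
each vector at which its form vanishes. -/
lemma IsFeasible.lmiMatrix_mulVec_one (h : IsFeasible n X) (hodd : Odd n) {j : ℕ}
    (hj : j ∈ Finset.Icc 1 (n / 2)) : lmiMatrix X j *ᵥ (fun _ => 1) = 0 := by
  have h1 := h.sum_dotProduct hodd (fun _ => 1)
  have h2 : (n : ℝ) * ((fun _ : Fin n => (1 : ℝ)) ⬝ᵥ fun _ => 1) - (∑ _a : Fin n, (1 : ℝ)) ^ 2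
      = 0 := by simp [dotProduct]; ring
  rw [h2, Finset.sum_eq_zero_iff_of_nonneg] at h1
  · rw [← (h.posSemidef hj).dotProduct_mulVec_zero_iff]
    have := h1 j hj
    simpa [star] using this
  · intro i hi
    have := (h.posSemidef hi).dotProduct_mulVec_nonneg (fun _ => 1)
    rw [star_trivial] at this
    positivity

lemma IsFeasible.row_sum (h : IsFeasible n X) (hodd : Odd n) (hn : 3 ≤ n) (a : Fin n) :
    ∑ b, X 1 a b = 2 := by
  have h1 := congrArg (fun A => (A *ᵥ fun _ => (1 : ℝ)) a)
    (h.sum_coeff_smul_lmiMatrix hodd hn)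
  have hn0 : (n : ℝ) ≠ 0 := by positivity
  simp only [sum_mulVec, sub_mulVec, smul_mulVec, ones_mulVec] at h1
  rw [Finset.sum_congr rfl fun j hj => by rw [h.lmiMatrix_mulVec_one hodd hj]] at h1
  simp [mulVec, dotProduct] at h1
  field_simp at h1
  have h2 : ∑ b, X 1 a b - 2 = 0 := mul_left_cancel₀ hn0 (by linarith)
  linarith

/-- The angles `2πj/n` lie in `[0, π]`, where cosine is decreasing. -/
lemma coeff_one_le {j : ℕ} (hj : j ∈ Finset.Icc 1 (n / 2)) : coeff n 1 j ≤ coeff n 1 1 := by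
  rw [Finset.mem_Icc] at hj
  have hn : (0 : ℝ) < n := by
    have : 0 < n := by omega
    exact_mod_cast this
  have hpi := Real.pi_pos
  have h1 : (1 : ℝ) ≤ j := by exact_mod_cast hj.1
  have h2 : 2 * (j : ℝ) ≤ n := by
    have : 2 * j ≤ n := by omega
    exact_mod_cast this
  apply Real.cos_le_cos_of_nonneg_of_le_pi
  · positivity
  · rw [div_le_iff₀ hn]; push_cast; nlinarith
  · push_cast; gcongr

lemma coeff_one_one_lt (hn : 3 ≤ n) : coeff n 1 1 < 1 := by
  have hn' : (3 : ℝ) ≤ n := by exact_mod_cast hn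
  have hpi := Real.pi_pos
  have : Real.cos (2 * ((1 : ℕ) : ℝ) * ((1 : ℕ) : ℝ) * Real.pi / n) < Real.cos 0 := by
    apply Real.cos_lt_cos_of_nonneg_of_le_pi le_rfl
    · rw [div_le_iff₀ (by linarith)]; push_cast; nlinarith
    · positivity
  simpa [coeff] using this

/-- The second largest eigenvalue of `X 1` is at most `2 cos (2 π / n)`. -/
lemma IsFeasible.dotProduct_le (h : IsFeasible n X) (hodd : Odd n) (hn : 3 ≤ n)
    {f : Fin n → ℝ} (hf : ∑ a, f a = 0) :
    f ⬝ᵥ X 1 *ᵥ f ≤ 2 * coeff n 1 1 * (f ⬝ᵥ f) := by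
  have hn' : (0 : ℝ) < n := by positivity
  have h1 := congrArg (fun A => f ⬝ᵥ A *ᵥ f) (h.sum_coeff_smul_lmiMatrix hodd hn)
  simp only [sum_mulVec, sub_mulVec, smul_mulVec, dotProduct_sum, dotProduct_sub,
    dotProduct_smul, ones_mulVec, smul_eq_mul, hf] at h1
  have h2 := h.sum_dotProduct hodd f
  -- Each form value is nonnegative, so every weight may be raised to the largest one.
  have h3 : ∑ j ∈ Finset.Icc 1 (n / 2), 2 * coeff n 1 j * (f ⬝ᵥ lmiMatrix X j *ᵥ f) ≤
      coeff n 1 1 * ∑ j ∈ Finset.Icc 1 (n / 2), 2 * (f ⬝ᵥ lmiMatrix X j *ᵥ f) := by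
    rw [Finset.mul_sum]
    refine Finset.sum_le_sum fun j hj => ?_
    have p := (h.posSemidef hj).dotProduct_mulVec_nonneg f
    rw [star_trivial] at p
    nlinarith [coeff_one_le hj]
  rw [h2, h1, hf] at h3
  have h4 : f ⬝ᵥ (fun _ : Fin n => (0 : ℝ)) = 0 := dotProduct_zero f
  rw [h4] at h3
  have h5 : n * (f ⬝ᵥ X 1 *ᵥ f) ≤ n * (2 * coeff n 1 1 * (f ⬝ᵥ f)) := by linarith
  exact le_of_mul_le_mul_left h5 hn'

lemma IsFeasible.eq_of_mulVec_eq (h : IsFeasible n X) (hodd : Odd n) (hn : 3 ≤ n)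
    {g : Fin n → ℝ} (hg : X 1 *ᵥ g = (2 : ℝ) • g) (a b : Fin n) : g a = g b := by
  -- `n` times the projection of `g` orthogonal to the all-ones vector; it is again fixed up to the
  -- factor 2, so the spectral bound forces it to vanish.
  set f : Fin n → ℝ := fun a => n * g a - ∑ b, g b with hfdef
  have hsum : ∑ a, f a = 0 := by simp [hfdef, ← Finset.mul_sum]
  have hf : X 1 *ᵥ f = (2 : ℝ) • f := by
    ext a
    have := congrFun hg a
    simp only [mulVec, dotProduct, Pi.smul_apply, smul_eq_mul, hfdef, mul_sub,
      Finset.sum_sub_distrib, ← Finset.sum_mul, h.row_sum hodd hn] at this ⊢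
    simp only [mul_left_comm _ (n : ℝ), ← Finset.mul_sum, this]
  have h1 := h.dotProduct_le hodd hn hsum
  rw [hf, dotProduct_smul, smul_eq_mul] at h1
  have h2 := coeff_one_one_lt hn
  have h3 : 0 ≤ f ⬝ᵥ f := by
    simpa using dotProduct_star_self_nonneg f
  have h4 : f ⬝ᵥ f = 0 := by nlinarith
  have h5 : f = 0 := dotProduct_self_eq_zero.mp h4
  have ha := congrFun h5 a
  have hb := congrFun h5 b
  have hn0 : (n : ℝ) ≠ 0 := by positivity
  simp only [hfdef, Pi.zero_apply] at ha hb
  exact mul_left_cancel₀ hn0 (by linarith)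

/-! ### The graph of `X 1` is a Hamiltonian cycle -/

lemma IsFeasible.diag_eq_zero (h : IsFeasible n X) (hn : 3 ≤ n) (a : Fin n) :
    X 1 a a = 0 := by
  have h1 := congrArg (fun A => A a a) h.sum_eq
  simp only [Matrix.add_apply, one_apply_eq, Matrix.sum_apply, of_apply, add_eq_left] at h1
  rw [Finset.sum_eq_zero_iff_of_nonneg] at h1
  · exact h1 1 (by rw [Finset.mem_Icc]; omega)
  · intro i hi
    rcases eq_or_ne i 1 with rfl | hi1
    · rcases h.binary_one a a with h | h <;> simp [h]
    · refine h.nonneg i ?_ a a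
      rw [Finset.mem_Icc] at *
      omega

/-- The graph whose adjacency matrix is `X 1`. -/
def IsFeasible.graph (h : IsFeasible n X) (hn : 3 ≤ n) : SimpleGraph (Fin n) where
  Adj a b := X 1 a b = 1
  symm := ⟨fun a b hab => by rw [h.symm_one.apply a b]; exact hab⟩
  loopless := ⟨fun a ha => by simp [h.diag_eq_zero hn a] at ha⟩

lemma IsFeasible.ncard_neighborSet (h : IsFeasible n X) (hodd : Odd n) (hn : 3 ≤ n)
    (a : Fin n) : ((h.graph hn).neighborSet a).ncard = 2 := by
  classical
  have h1 := h.row_sum hodd hn a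
  have h2 : ∀ b, X 1 a b = if X 1 a b = 1 then 1 else 0 := by
    intro b
    rcases h.binary_one a b with h | h <;> simp [h]
  rw [Finset.sum_congr rfl fun b _ => h2 b, Finset.sum_boole] at h1
  have h3 : (h.graph hn).neighborSet a = ↑(Finset.univ.filter fun b => X 1 a b = 1) := by
    ext b; simp [graph]
  rw [h3, Set.ncard_coe_finset]
  exact_mod_cast h1

/-- The indicator of a component is an eigenvector of `X 1` for the eigenvalue 2, hence constant. -/
lemma IsFeasible.supp_eq_univ (h : IsFeasible n X) (hodd : Odd n) (hn : 3 ≤ n)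
    (c : (h.graph hn).ConnectedComponent) : c.supp = Set.univ := by
  classical
  have hg : X 1 *ᵥ (fun a => if a ∈ c.supp then (1 : ℝ) else 0) =
      (2 : ℝ) • fun a => if a ∈ c.supp then (1 : ℝ) else 0 := by
    ext a
    simp only [mulVec, dotProduct, Pi.smul_apply, smul_eq_mul]
    rw [← h.row_sum hodd hn a, Finset.sum_mul]
    refine Finset.sum_congr rfl fun b _ => ?_
    rcases h.binary_one a b with h0 | h1
    · simp [h0]
    · have : a ∈ c.supp ↔ b ∈ c.supp := c.mem_supp_congr_adj (v := a) (w := b) h1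
      simp [this]
  obtain ⟨v, hv⟩ := c.nonempty_supp
  refine Set.eq_univ_of_forall fun a => ?_
  have := h.eq_of_mulVec_eq hodd hn hg a v
  by_contra ha
  simp [ha, hv] at this

theorem IsFeasible.exists_tour (h : IsFeasible n X) (hodd : Odd n) (hn : 3 ≤ n) :
    ∃ T : Tour n, T.adjMatrix = X 1 := by
  classical
  set G := h.graph hn with hG
  let v : Fin n := ⟨0, by omega⟩
  have hcyc : G.IsCycles := fun a _ => h.ncard_neighborSet hodd hn a
  have hne : (G.neighborSet v).Nonempty := by
    rw [← Set.ncard_pos, h.ncard_neighborSet hodd hn]; norm_num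
  obtain ⟨p, hp, hverts⟩ := hcyc.exists_cycle_toSubgraph_verts_eq_connectedComponentSupp
    (c := G.connectedComponentMk v) (by simp) hne
  rw [h.supp_eq_univ hodd hn] at hverts
  have hmem : ∀ w, w ∈ p.support := fun w => by
    rw [← SimpleGraph.Walk.mem_verts_toSubgraph, hverts]; trivial
  have hham : p.IsHamiltonianCycle := by
    rw [SimpleGraph.Walk.isHamiltonianCycle_isCycle_and_isHamiltonian_tail]
    refine ⟨hp, hp.isPath_tail.isHamiltonian_of_mem fun w => ?_⟩
    rw [SimpleGraph.Walk.support_tail_of_not_nil _ hp.not_nil]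
    have := hmem w
    rw [SimpleGraph.Walk.mem_support_iff] at this
    rcases this with rfl | h
    · exact SimpleGraph.Walk.end_mem_tail_support hp.not_nil
    · exact h
  refine ⟨⟨v, p.mapLe le_top, hham.map Function.bijective_id⟩, ?_⟩
  ext a b
  -- The cycle visits every vertex and already uses both edges there, so no edge of the graph is
  -- missed.
  have hiff : s(a, b) ∈ p.edges ↔ X 1 a b = 1 := by
    rw [← SimpleGraph.Walk.adj_toSubgraph_iff_mem_edges]
    exact (hp.adj_toSubgraph_iff_of_isCycles hcyc (by rw [hverts]; trivial) b)
  simp only [Tour.adjMatrix, of_apply, SimpleGraph.Walk.edges_mapLe_eq_edges, hiff]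
  rcases h.binary_one a b with h | h <;> simp [h]

end TSPAssoc

namespace TSPAssoc

open Matrix

/-! ### Cost of a tour as a trace -/

lemma sum_mul_edge_indicator {n : ℕ} {D : Matrix (Fin n) (Fin n) ℝ} (hD : D.IsSymm)
    (L : List (⊤ : SimpleGraph (Fin n)).Dart) (hL : (L.map SimpleGraph.Dart.edge).Nodup) :
    ∑ a, ∑ b, D a b * (if s(a, b) ∈ L.map SimpleGraph.Dart.edge then 1 else 0) =
      2 * (L.map fun d => D d.fst d.snd).sum := by
  induction L with
  | nil => simp
  | cons d L ih =>
    rw [List.map_cons, List.nodup_cons] at hL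
    have hne : d.fst ≠ d.snd := d.adj.ne
    -- The edge of `d` is new and not a loop, so it contributes exactly two ordered pairs.
    have h1 : ∀ a b, (if s(a, b) ∈ (d :: L).map SimpleGraph.Dart.edge then (1 : ℝ) else 0) =
        (if s(a, b) ∈ L.map SimpleGraph.Dart.edge then 1 else 0) +
          ((if a = d.fst then if b = d.snd then 1 else 0 else 0) +
            if a = d.snd then if b = d.fst then 1 else 0 else 0) := by
      intro a b
      have he : s(a, b) = d.edge ↔ (a = d.fst ∧ b = d.snd) ∨ (a = d.snd ∧ b = d.fst) := by
        change s(a, b) = s(d.fst, d.snd) ↔ _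
        rw [Sym2.eq_iff]
      simp only [List.map_cons, List.mem_cons]
      by_cases h : s(a, b) = d.edge
      · have hnot : ¬ s(a, b) ∈ L.map SimpleGraph.Dart.edge := h ▸ hL.1
        rw [if_pos (Or.inl h), if_neg hnot]
        rcases he.mp h with ⟨rfl, rfl⟩ | ⟨rfl, rfl⟩
        · simp [hne]
        · simp [hne.symm]
      · have h2 := mt he.mpr h
        push Not at h2
        have h3 : (if a = d.fst then if b = d.snd then (1 : ℝ) else 0 else 0) = 0 := by
          split_ifs with h4 h5
          exacts [absurd h5 (h2.1 h4), rfl, rfl]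
        have h6 : (if a = d.snd then if b = d.fst then (1 : ℝ) else 0 else 0) = 0 := by
          split_ifs with h4 h5
          exacts [absurd h5 (h2.2 h4), rfl, rfl]
        rw [h3, h6]
        simp [h]
    simp only [h1, mul_add, Finset.sum_add_distrib, ih hL.2]
    simp only [mul_ite, mul_one, mul_zero, List.map_cons, List.sum_cons]
    have h7 : ∀ x y : Fin n, ∑ a, ∑ b, (if a = x then if b = y then D a b else 0 else 0)
        = D x y := by
      intro x y
      rw [Finset.sum_eq_single x (by intro a _ h; simp [h]) (by simp)]
      simp
    rw [h7, h7, hD.apply d.fst d.snd]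
    ring

theorem Tour.cost_eq {n : ℕ} {D : Matrix (Fin n) (Fin n) ℝ} (hD : D.IsSymm) (T : Tour n) :
    T.cost D = (1 / 2 : ℝ) * traceInner D T.adjMatrix := by
  have h := sum_mul_edge_indicator hD T.walk.darts
    (by rw [← SimpleGraph.Walk.edges_eq_map_darts]; exact T.isHamiltonianCycle.isCycle.edges_nodup)
  rw [← SimpleGraph.Walk.edges_eq_map_darts] at h
  have h2 : traceInner D T.adjMatrix =
      ∑ a, ∑ b, D a b * (if s(a, b) ∈ T.walk.edges then 1 else 0) := by
    rw [Finset.sum_comm]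
    simp [traceInner, trace, mul_apply, adjMatrix]
  rw [h2, h, cost]
  ring

/-! ### Distances along a tour -/

variable {n : ℕ}

lemma Tour.length_walk (T : Tour n) : T.walk.length = n := by
  simpa using T.isHamiltonianCycle.length_eq

lemma Tour.exists_getVert (T : Tour n) (a : Fin n) : ∃ k < n, T.walk.getVert k = a := by
  have hn : 0 < n := a.pos
  obtain ⟨k, hk, hkn⟩ := SimpleGraph.Walk.mem_support_iff_exists_getVert.mp
    (T.isHamiltonianCycle.mem_support a)
  rw [T.length_walk] at hkn
  rcases hkn.lt_or_eq with h | h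
  · exact ⟨k, h, hk⟩
  -- Index `n` is the return to the base vertex, which is counted at index 0.
  · refine ⟨0, hn, ?_⟩
    rw [← hk, SimpleGraph.Walk.getVert_zero,
      SimpleGraph.Walk.getVert_of_length_le _ (by rw [T.length_walk, h])]

/-- The position at which the tour visits a vertex. -/
noncomputable def Tour.pos (T : Tour n) (a : Fin n) : ℕ := (T.exists_getVert a).choose

lemma Tour.pos_lt (T : Tour n) (a : Fin n) : T.pos a < n := (T.exists_getVert a).choose_spec.1

lemma Tour.getVert_pos (T : Tour n) (a : Fin n) : T.walk.getVert (T.pos a) = a :=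
  (T.exists_getVert a).choose_spec.2

lemma Tour.pos_getVert (T : Tour n) {k : ℕ} (hk : k < n) : T.pos (T.walk.getVert k) = k := by
  have := T.pos_lt (T.walk.getVert k)
  apply T.isHamiltonianCycle.isCycle.getVert_injOn'
  · simp only [Set.mem_ofPred_eq, T.length_walk]; omega
  · simp only [Set.mem_ofPred_eq, T.length_walk]; omega
  · exact T.getVert_pos _

lemma Tour.getVert_card (T : Tour n) : T.walk.getVert n = T.walk.getVert 0 := by
  rw [SimpleGraph.Walk.getVert_zero,
    SimpleGraph.Walk.getVert_of_length_le _ T.length_walk.le]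

/-- The distance between two vertices along the tour. -/
noncomputable def Tour.dist (T : Tour n) (a b : Fin n) : ℕ :=
  min ((T.pos a : ℤ) - T.pos b).natAbs (n - ((T.pos a : ℤ) - T.pos b).natAbs)

lemma Tour.dist_comm (T : Tour n) (a b : Fin n) : T.dist a b = T.dist b a := by
  simp only [dist]; omega

lemma Tour.dist_eq_zero (T : Tour n) {a b : Fin n} : T.dist a b = 0 ↔ a = b := by
  have ha := T.pos_lt a
  have hb := T.pos_lt b
  constructor
  · intro h
    rw [← T.getVert_pos a, ← T.getVert_pos b]
    congr 1
    simp only [dist] at h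
    omega
  · rintro rfl
    simp [dist]

lemma Tour.dist_le (T : Tour n) (a b : Fin n) : T.dist a b ≤ n / 2 := by
  simp only [dist]; omega

lemma Tour.mem_edges_iff (T : Tour n) (hn : 3 ≤ n) (a b : Fin n) :
    s(a, b) ∈ T.walk.edges ↔ T.dist a b = 1 := by
  have ha := T.pos_lt a
  have hb := T.pos_lt b
  rw [SimpleGraph.Walk.mk_mem_edges_iff_exists, T.length_walk]
  constructor
  · rintro ⟨i, hi, he⟩
    have key : T.dist (T.walk.getVert i) (T.walk.getVert (i + 1)) = 1 := by
      rcases (show i + 1 ≤ n from hi).lt_or_eq with h | h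
      · simp only [dist, T.pos_getVert hi, T.pos_getVert h]; omega
      -- The closing edge joins positions `n - 1` and 0.
      · rw [h, T.getVert_card]
        simp only [dist, T.pos_getVert hi, T.pos_getVert (show 0 < n by omega)]; omega
    rcases Sym2.eq_iff.mp he with ⟨h1, h2⟩ | ⟨h1, h2⟩
    · rwa [h1, h2] at key
    · rwa [h1, h2, T.dist_comm] at key
  · intro h
    have cases : T.pos b = T.pos a + 1 ∨ T.pos a = T.pos b + 1 ∨
        (T.pos a + 1 = n ∧ T.pos b = 0) ∨ (T.pos b + 1 = n ∧ T.pos a = 0) := by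
      simp only [dist] at h; omega
    have ga := T.getVert_pos a
    have gb := T.getVert_pos b
    rcases cases with h | h | ⟨h, h'⟩ | ⟨h, h'⟩
    · exact ⟨T.pos a, ha, by rw [← h, ga, gb]⟩
    · exact ⟨T.pos b, hb, by rw [← h, ga, gb, Sym2.eq_swap]⟩
    · exact ⟨T.pos a, ha, by rw [h, T.getVert_card, ga, ← h', gb]⟩
    · exact ⟨T.pos b, hb, by rw [h, T.getVert_card, gb, ← h', ga, Sym2.eq_swap]⟩

/-- The distance matrices of a tour, which form the association scheme of the `n`-cycle. -/
noncomputable def Tour.distMatrix (T : Tour n) (i : ℕ) : Matrix (Fin n) (Fin n) ℝ :=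
  Matrix.of fun a b => if T.dist a b = i then 1 else 0

lemma Tour.distMatrix_one (T : Tour n) (hn : 3 ≤ n) : T.distMatrix 1 = T.adjMatrix := by
  ext a b
  simp [distMatrix, adjMatrix, T.mem_edges_iff hn]

lemma Tour.isSymm_distMatrix (T : Tour n) (i : ℕ) : (T.distMatrix i).IsSymm := by
  ext a b
  simp [distMatrix, T.dist_comm a b]

lemma Tour.one_add_sum_smul_distMatrix (T : Tour n) (w : ℕ → ℝ) (h0 : w 0 = 1) :
    1 + ∑ i ∈ Finset.Icc 1 (n / 2), w i • T.distMatrix i =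
      Matrix.of fun a b => w (T.dist a b) := by
  ext a b
  simp only [Matrix.add_apply, Matrix.sum_apply, Matrix.smul_apply, distMatrix, of_apply,
    smul_eq_mul, mul_ite, mul_one, mul_zero, Finset.sum_ite_eq, Finset.mem_Icc, T.dist_le,
    and_true]
  rcases eq_or_ne a b with rfl | h
  · simp [T.dist_eq_zero.mpr rfl, h0]
  · have : 1 ≤ T.dist a b := Nat.one_le_iff_ne_zero.mpr (mt T.dist_eq_zero.mp h)
    simp [h, this]

/-- Up to sign and a shift by `n`, the distance is the difference of positions; cosine is even, and
a shift by `n` moves the angle by `2πj`. -/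
lemma Tour.cos_dist (T : Tour n) (a b : Fin n) (j : ℕ) :
    Real.cos (2 * (T.dist a b : ℝ) * j * Real.pi / n) =
      Real.cos (2 * T.pos a * j * Real.pi / n - 2 * T.pos b * j * Real.pi / n) := by
  have ha := T.pos_lt a
  have hb := T.pos_lt b
  have hn : (n : ℝ) ≠ 0 := by
    have : n ≠ 0 := by omega
    exact_mod_cast this
  have cases : ((T.dist a b : ℤ) = T.pos a - T.pos b ∨ (T.dist a b : ℤ) = T.pos b - T.pos a) ∨
      (T.dist a b : ℤ) = n - (T.pos a - T.pos b) ∨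
      (T.dist a b : ℤ) = n - (T.pos b - T.pos a) := by
    simp only [dist]; omega
  rcases cases with (h | h) | h | h <;>
    (have h' := congrArg (Int.cast : ℤ → ℝ) h
     push_cast at h'
     rw [h'])
  · congr 1; ring
  · rw [← Real.cos_neg]; congr 1; ring
  · rw [← Real.cos_nat_mul_two_pi_sub _ j]; congr 1; field_simp; ring
  · rw [← Real.cos_neg (_ - _), ← Real.cos_nat_mul_two_pi_sub _ j]; congr 1; field_simp; ring

theorem Tour.isFeasible_distMatrix (T : Tour n) : IsFeasible n T.distMatrix where
  sum_eq := by
    simpa using T.one_add_sum_smul_distMatrix (fun _ => 1) rfl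
  lmi j _ := by
    rw [T.one_add_sum_smul_distMatrix
      (fun i => Real.cos (2 * (i : ℝ) * (j : ℝ) * Real.pi / (n : ℝ))) (by simp)]
    -- The formula for `cos (x - y)` splits the matrix into two rank-one squares.
    have h : (Matrix.of fun a b => Real.cos (2 * (T.dist a b : ℝ) * j * Real.pi / n)) =
        vecMulVec (fun a => Real.cos (2 * T.pos a * j * Real.pi / n))
          (star fun a => Real.cos (2 * T.pos a * j * Real.pi / n)) +
        vecMulVec (fun a => Real.sin (2 * T.pos a * j * Real.pi / n))
          (star fun a => Real.sin (2 * T.pos a * j * Real.pi / n)) := by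
      ext a b
      simp only [of_apply, T.cos_dist, Real.cos_sub, Matrix.add_apply, vecMulVec_apply,
        star_trivial]
    rw [h]
    exact (posSemidef_vecMulVec_self_star _).add (posSemidef_vecMulVec_self_star _)
  symm_one := T.isSymm_distMatrix 1
  binary_one a b := by
    simp only [distMatrix, of_apply]
    split_ifs <;> simp
  nonneg i _ a b := by
    simp only [distMatrix, of_apply]
    split_ifs <;> simp
  symm i _ := T.isSymm_distMatrix i

/-! ### Existence of the minimum -/

lemma nonempty_tour (hn : 3 ≤ n) : Nonempty (Tour n) := by
  obtain ⟨m, rfl⟩ := Nat.exists_eq_add_of_le' hn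
  refine ⟨⟨_, (SimpleGraph.cycleGraph.cycle m).mapLe le_top, ?_⟩⟩
  rw [SimpleGraph.Walk.isHamiltonianCycle_iff_isCycle_and_length_eq]
  refine ⟨SimpleGraph.cycleGraph.isCycle_cycle.mapLe _, ?_⟩
  simp

/-- The cost depends only on the 0/1 adjacency matrix, of which there are finitely many, so tours
themselves need not be counted. -/
lemma finite_range_cost {D : Matrix (Fin n) (Fin n) ℝ} (hD : D.IsSymm) :
    (Set.range fun T : Tour n => T.cost D).Finite := by
  refine (Set.finite_range fun S : Fin n → Fin n → Bool =>
    (1 / 2 : ℝ) * traceInner D (Matrix.of fun a b => if S a b then 1 else 0)).subset ?_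
  rintro _ ⟨T, rfl⟩
  refine ⟨fun a b => decide (s(a, b) ∈ T.walk.edges), ?_⟩
  simp [T.cost_eq hD, Tour.adjMatrix]

end TSPAssoc

theorem mainTheorem11 (n : ℕ) (hodd : Odd n) (hn : 3 ≤ n)
    (D : Matrix (Fin n) (Fin n) ℝ) (hD : D.IsSymm) :
    -- the feasible matrices `X₁` are exactly the adjacency matrices of Hamiltonian cycles
    (∀ Y : Matrix (Fin n) (Fin n) ℝ,
      (∃ X : ℕ → Matrix (Fin n) (Fin n) ℝ, TSPAssoc.IsFeasible n X ∧ X 1 = Y) ↔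
        ∃ T : TSPAssoc.Tour n, T.adjMatrix = Y) ∧
    -- corresponding solutions have the same objective value
    (∀ (X : ℕ → Matrix (Fin n) (Fin n) ℝ) (T : TSPAssoc.Tour n),
      TSPAssoc.IsFeasible n X → X 1 = T.adjMatrix → TSPAssoc.objective D X = T.cost D) ∧
    -- both minima are attained and coincide
    (∃ z : ℝ,
      IsLeast (TSPAssoc.objective D '' {X | TSPAssoc.IsFeasible n X}) z ∧
      IsLeast (Set.range fun T : TSPAssoc.Tour n => T.cost D) z) ∧
    -- corresponding solutions are optimal simultaneously
    (∀ (X : ℕ → Matrix (Fin n) (Fin n) ℝ) (T : TSPAssoc.Tour n),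
      TSPAssoc.IsFeasible n X → X 1 = T.adjMatrix →
        ((∀ X' : ℕ → Matrix (Fin n) (Fin n) ℝ, TSPAssoc.IsFeasible n X' →
            TSPAssoc.objective D X ≤ TSPAssoc.objective D X') ↔
          ∀ T' : TSPAssoc.Tour n, T.cost D ≤ T'.cost D)) := by
  have hobj : ∀ (X : ℕ → Matrix (Fin n) (Fin n) ℝ) (T : TSPAssoc.Tour n),
      X 1 = T.adjMatrix → TSPAssoc.objective D X = T.cost D := fun X T h => by
    rw [T.cost_eq hD, TSPAssoc.objective, h]
  -- Both problems have the same set of values, so attainment for tours settles both minima.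
  have himage : TSPAssoc.objective D '' {X | TSPAssoc.IsFeasible n X} =
      Set.range fun T : TSPAssoc.Tour n => T.cost D := by
    ext z
    constructor
    · rintro ⟨X, hX, rfl⟩
      obtain ⟨T, hT⟩ := hX.exists_tour hodd hn
      exact ⟨T, (hobj X T hT.symm).symm⟩
    · rintro ⟨T, rfl⟩
      exact ⟨T.distMatrix, T.isFeasible_distMatrix, hobj _ T (T.distMatrix_one hn)⟩
  refine ⟨fun Y => ⟨?_, ?_⟩, fun X T _ h => hobj X T h, ?_, fun X T _ h => ?_⟩
  · rintro ⟨X, hX, rfl⟩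
    exact hX.exists_tour hodd hn
  · rintro ⟨T, rfl⟩
    exact ⟨T.distMatrix, T.isFeasible_distMatrix, T.distMatrix_one hn⟩
  · have : Nonempty (TSPAssoc.Tour n) := TSPAssoc.nonempty_tour hn
    obtain ⟨z, hz, hmin⟩ := Set.exists_min_image _ id (TSPAssoc.finite_range_cost hD)
      (Set.range_nonempty _)
    rw [himage]
    exact ⟨z, ⟨hz, hmin⟩, hz, hmin⟩
  · rw [hobj X T h]
    constructor
    · intro hopt T'
      rw [← hobj _ T' (T'.distMatrix_one hn)]
      exact hopt _ (T'.isFeasible_distMatrix)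
    · intro hopt X' hX'
      obtain ⟨T', hT'⟩ := hX'.exists_tour hodd hn
      rw [hobj X' T' hT'.symm]
      exact hopt T'
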